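/- Let $p$ be a prime, and let $|\cdot|_p$ be the $p$-adic absolute value, extended to $\overline{\mathbb{Q}}_p$ and its completion; $\mathbb{N}=\{1,2,\dots\}$. **Words.** For $N\ge 1$ let $\mathcal{A}_N=\{1,\dots,N\}$. For an infinite word $w=a_1a_2a_3\cdots$ of positive integers let $\mathrm{T}w=a_2a_3\cdots$ and let $w_n=a_1\cdots a_n$ be its prefix of length $n\ge 0$. For $a\in\mathbb{N}$ put $M_a=\begin{pmatrix}0&1\\1&a\end{pmatrix}$, and for a finite word $u=a_1\cdots a_n$ put $M_u=M_{a_1}\cdots M_{a_n}$ (the identity matrix if $u$ is empty). For $k,n\ge0$ let $$V(n,w)=\{M_{w_m}: m\ge 0,\ w_n \text{ is a prefix of } \mathrm{T}^m w\},$$ and let $V_k(n,w)$ be the image of $V(n,w)$ under reduction modulo $p^k$. Let $\phi_k$ also denote reduction modulo $p^k$ of matrices over $\mathbb{Z}_p$. **The sets $\mathbf{LMad}_\epsilon$.** For $\epsilon>0$ let $\mathbf{PBad}_\epsilon$ be the set of points $(q_1:q_2)\in\mathbf{P}^1_{\mathbb{Q}_p}$ such that for all $(a,b)\in\mathbb{Z}^2\setminus\{(0,0)\}$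 $$|aq_1+bq_2|_p\cdot\min\{|q_1|_p^{-1},|q_2|_p^{-1}\}\ \ge\ \epsilon\cdot\min\{|a|^{-2},|b|^{-2}\},$$ where the inverse of $0$ is read as $+\infty$. Extend $\mathrm{T}$ to pairs by $\mathrm{T}(w,\mathbf{q})=(\mathrm{T}w,M_{a_1}\mathbf{q})$, where $a_1$ is the first letter of $w$. Let $\mathbf{LMad}_\epsilon$ be the set of pairs $(w,\mathbf{x}_p)$ such that $\mathrm{T}^n(w,\mathbf{x}_p)\in\mathcal{A}_{\lfloor\epsilon^{-1}\rfloor+1}^{\mathbb{N}}\times\mathbf{PBad}_\epsilon$ for every $n\in\mathbb{N}$. **The class $\widetilde{\mathrm{SL}}_2(\mathbb{Z}_p)$.** It consists of the $2\times2$ matrices $A$ over $\mathbb{Z}_p$ with $\det A=\pm1$ that have two different eigenvectors in $\mathbf{P}^1_{\overline{\mathbb{Q}}_p}$ and are such that, for a positive integer $\kappa\le p^2$ with $|\lambda^{\kappa}-1|_p\le p^{-1}$ for each eigenvalue $\lambda$ of $A$, one has $\log(\lambda^{\kappa})\ne0$ for each eigenvalue $\lambda$ of $A$. Here $\log x=\sum_{n\ge1}(-1)^{n-1}(x-1)^n/n$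 for $|x-1|_p<1$. (Such a $\kappa$ always exists, and the condition does not depend on its choice.) **Theorem 6.1.** Let $A_1,A_2\in\widetilde{\mathrm{SL}}_2(\mathbb{Z}_p)$ be such that the eigenvectors $\mathbf{w}_1,\mathbf{w}_2$ of $A_1$ and $\mathbf{w}_3,\mathbf{w}_4$ of $A_2$ in $\mathbf{P}^1_{\overline{\mathbb{Q}}_p}$ are four distinct points. Then there is a constant $c>0$, depending only on $A_1$, $A_2$ and $p$, with the following property. Let $N\ge1$, let $w\in\mathcal{A}_N^{\mathbb{N}}$, and suppose that for some $k\ge0$ one has $\phi_k(A_1),\phi_k(A_2)\in V_k(n,w)$ for all $n\ge0$. Then for every $\mathbf{x}_p\in\mathbf{P}^1_{\mathbb{Q}_p}$ and every $\epsilon\ge c\,p^{-k}$ one has $(w,\mathbf{x}_p)\notin\mathbf{LMad}_\epsilon$. -/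

import Mathlib

open scoped LinearAlgebra.Projectivization

namespace PLC

/-! ### Words and their matrices -/

/-- The left shift on infinite words; the letters of `w` are `w 0, w 1, w 2, …`. -/
def shift (w : ℕ → ℕ) : ℕ → ℕ := fun i => w (i + 1)

/-- The prefix of length `n` of an infinite word. -/
def pre (w : ℕ → ℕ) (n : ℕ) : List ℕ := (List.range n).map w

/-- The infinite words over the alphabet `{1, …, N}`. -/
def words (N : ℕ) : Set (ℕ → ℕ) := {w | ∀ i, 1 ≤ w i ∧ w i ≤ N}

/-- The matrix of a single letter. -/
def letterMatrix (a : ℕ) : Matrix (Fin 2) (Fin 2) ℤ := !![0, 1; 1, (a : ℤ)]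

/-- The matrix of a finite word: the product, in order, of the matrices of its letters. -/
def wordMatrix (l : List ℕ) : Matrix (Fin 2) (Fin 2) ℤ := (l.map letterMatrix).prod

/-- `V(n, w)`: the matrices of those prefixes of `w` (of any length `m ≥ 0`) after which the word
starts again with its own prefix of length `n`. -/
def V (n : ℕ) (w : ℕ → ℕ) : Set (Matrix (Fin 2) (Fin 2) ℤ) :=
  {M | ∃ m : ℕ, pre (shift^[m] w) n = pre w n ∧ M = wordMatrix (pre w m)}

/-- `V_k(n, w)`: the reduction of `V(n, w)` modulo `p ^ k`. -/
def Vmod (p k n : ℕ) (w : ℕ → ℕ) : Set (Matrix (Fin 2) (Fin 2) (ZMod (p ^ k))) :=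
  (fun M => M.map (Int.castRingHom (ZMod (p ^ k)))) '' V n w

/-! ### The action on the projective line and the sets of badly approximable points -/

section Line

variable (p : ℕ) [Fact p.Prime]

/-- The projective line over the `p`-adic numbers. -/
abbrev Line : Type := ℙ ℚ_[p] (Fin 2 → ℚ_[p])

/-- The letter matrix over the `p`-adic numbers. -/
noncomputable def letterMatrixQ (a : ℕ) : Matrix (Fin 2) (Fin 2) ℚ_[p] :=
  (letterMatrix a).map (Int.castRingHom ℚ_[p])

theorem letterMatrixQ_injective (a : ℕ) :
    Function.Injective (Matrix.toLin' (letterMatrixQ p a)) := by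
  have hdet : (letterMatrixQ p a).det = -1 := by
    simp [letterMatrixQ, letterMatrix, Matrix.det_fin_two]
  have hu : IsUnit (letterMatrixQ p a) := by
    rw [Matrix.isUnit_iff_isUnit_det, hdet]
    exact isUnit_one.neg
  have h := Matrix.mulVec_injective_of_isUnit hu
  intro x y hxy
  exact h (by simpa [Matrix.toLin'_apply] using hxy)

/-- The action `q ↦ A_a q` on the projective line. -/
noncomputable def letterAct (a : ℕ) : Line p → Line p :=
  Projectivization.map (Matrix.toLin' (letterMatrixQ p a)) (letterMatrixQ_injective p a)

/-- The extended shift `T(w, q) = (Tw, A_{a₁} q)`, where `a₁` is the first letter of `w`. -/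
noncomputable def T (x : (ℕ → ℕ) × Line p) : (ℕ → ℕ) × Line p :=
  (shift x.1, letterAct p (x.1 0) x.2)

/-- The defining inequality of a `p`-adically badly approximable vector with constant `ε`:
`|a q₁ + b q₂|_p · min(|q₁|_p⁻¹, |q₂|_p⁻¹) ≥ min(|a|⁻², |b|⁻²) · ε` for all integers
`(a, b) ≠ (0, 0)`. With the convention that the inverse of `0` is `+∞`, the first minimum is
`max(|q₁|_p, |q₂|_p)⁻¹` and the second one is `max(|a|, |b|)⁻²`, as written here. -/
def BadVec (ε : ℝ) (v : Fin 2 → ℚ_[p]) : Prop :=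
  ∀ a b : ℤ, (a, b) ≠ (0, 0) →
    ((max |(a : ℝ)| |(b : ℝ)|) ^ 2)⁻¹ * ε ≤
      ‖(a : ℚ_[p]) * v 0 + (b : ℚ_[p]) * v 1‖ * (max ‖v 0‖ ‖v 1‖)⁻¹

/-- The points of the projective line that are `p`-adically badly approximable with constant `ε`. -/
def PBad (ε : ℝ) : Set (Line p) := {q | BadVec p ε q.rep}

theorem badVec_smul (ε : ℝ) (v : Fin 2 → ℚ_[p]) (c : ℚ_[p]) (hc : c ≠ 0) :
    BadVec p ε (c • v) ↔ BadVec p ε v := by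
  have hc' : ‖c‖ ≠ 0 := norm_ne_zero_iff.mpr hc
  unfold BadVec
  refine forall_congr' fun a => forall_congr' fun b => imp_congr_right fun _ => ?_
  have h1 : (a : ℚ_[p]) * (c • v) 0 + (b : ℚ_[p]) * (c • v) 1
      = c * ((a : ℚ_[p]) * v 0 + (b : ℚ_[p]) * v 1) := by
    simp only [Pi.smul_apply, smul_eq_mul]; ring
  have h2 : max ‖(c • v) 0‖ ‖(c • v) 1‖ = ‖c‖ * max ‖v 0‖ ‖v 1‖ := by
    simp only [Pi.smul_apply, smul_eq_mul, norm_mul]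
    exact (mul_max_of_nonneg _ _ (norm_nonneg c)).symm
  rw [h1, h2, norm_mul, mul_inv, mul_mul_mul_comm, mul_inv_cancel₀ hc', one_mul]

/-- Membership in `PBad` may be tested on any homogeneous coordinates of the point. -/
theorem mk_mem_PBad (ε : ℝ) (v : Fin 2 → ℚ_[p]) (hv : v ≠ 0) :
    Projectivization.mk ℚ_[p] v hv ∈ PBad p ε ↔ BadVec p ε v := by
  obtain ⟨c, hc⟩ := Projectivization.exists_smul_eq_mk_rep ℚ_[p] v hv
  change BadVec p ε (Projectivization.mk ℚ_[p] v hv).rep ↔ _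
  rw [← hc]
  exact badVec_smul p ε v c c.ne_zero

/-- `LMad_ε`: the pairs `(w, q)` such that `Tⁿ(w, q)` lies in `{1, …, N}^ℕ × PBad_ε` for every
positive integer `n`, where `N = ⌊ε⁻¹⌋ + 1`. -/
def LMad (ε : ℝ) : Set ((ℕ → ℕ) × Line p) :=
  {x | ∀ n : ℕ, 1 ≤ n →
    ((T p)^[n] x).1 ∈ words (⌊ε⁻¹⌋₊ + 1) ∧ ((T p)^[n] x).2 ∈ PBad p ε}

end Line

/-! ### The class of matrices -/

section Matrices

variable (p : ℕ) [Fact p.Prime]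

/-- A `p`-adic integer matrix over the algebraic closure of the `p`-adic numbers. -/
noncomputable def toAlgCl (A : Matrix (Fin 2) (Fin 2) ℤ_[p]) :
    Matrix (Fin 2) (Fin 2) (PadicAlgCl p) :=
  A.map (fun x => algebraMap ℚ_[p] (PadicAlgCl p) (x : ℚ_[p]))

/-- The eigenvectors of `A`, as points of the projective line over the algebraic closure. -/
def eigenpoints (A : Matrix (Fin 2) (Fin 2) ℤ_[p]) :
    Set (ℙ (PadicAlgCl p) (Fin 2 → PadicAlgCl p)) :=
  {v | ∃ μ : PadicAlgCl p, Module.End.HasEigenvector (Matrix.toLin' (toAlgCl p A)) μ v.rep}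

/-- The `p`-adic logarithm series `∑_{n ≥ 1} (-1)^(n-1) (x - 1)^n / n`, which converges for
`|x - 1|_p < 1`. -/
noncomputable def plog (x : ℂ_[p]) : ℂ_[p] :=
  ∑' n : ℕ, (-1 : ℂ_[p]) ^ n * (x - 1) ^ (n + 1) / ((n + 1 : ℕ) : ℂ_[p])

/-- The matrices over `ℤ_p` of determinant `±1` with two different eigenvectors in the projective
line over the algebraic closure, such that for a positive integer `κ ≤ p²` with
`|λ^κ - 1|_p ≤ p⁻¹` for each eigenvalue `λ`, the logarithms `log (λ^κ)` of both eigenvalues are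
non-zero. (Such an exponent always exists, and since `log (x ^ j) = j log x` the condition on the
logarithms does not depend on which one is taken.) -/
def SLtilde : Set (Matrix (Fin 2) (Fin 2) ℤ_[p]) :=
  {A | (A.det = 1 ∨ A.det = -1) ∧ (eigenpoints p A).Nontrivial ∧
    ∃ κ : ℕ, 0 < κ ∧ κ ≤ p ^ 2 ∧
      ∀ l : PadicAlgCl p, Module.End.HasEigenvalue (Matrix.toLin' (toAlgCl p A)) l →
        ‖l ^ κ - 1‖ ≤ (p : ℝ)⁻¹ ∧ plog p ((l ^ κ : PadicAlgCl p) : ℂ_[p]) ≠ 0}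

/-- Reduction of a matrix over `ℤ_p` modulo `p ^ k`. -/
noncomputable def red (k : ℕ) (A : Matrix (Fin 2) (Fin 2) ℤ_[p]) :
    Matrix (Fin 2) (Fin 2) (ZMod (p ^ k)) :=
  A.map (PadicInt.toZModPow k)

end Matrices

end PLC

/-!
Some power of `Aᵢ` has the form `1 + p² Y`, and `(1 + p² Y) ^ (p ^ k) ≡ 1 + p ^ (k + 2) Y` modulo
`p ^ (k + 3)`. Hence, if `p² (X ⬝ Y v)` is nonzero and divides `X ⬝ v`, then `X ⬝ (1 + p² Y)ⁿ v` can
be made divisible by any power of `p`, correcting one digit of `n` at a time. Let `X` be primitive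
coordinates of the point `x_p`. Truncating the `p`-adic digits of a vector `X^⊥` orthogonal to `X`
yields an integral vector `v`, of size bounded in terms of the valuation of the quadratic form
`X ⬝ Y X^⊥`, to which this applies.

The reductions modulo `p ^ k` of matrices that return to every prefix of `w` are closed under
products. So if `Aᵢ` reduces to one of them then so does `Aᵢ ^ t`, and `X ⬝ Aᵢ ^ t v ≡ 0` modulo
`p ^ k` says that the bounded vector `v` violates, up to `O(p ^ (-k))`, the bad approximability of
an iterate of `x_p` under `T`.

The form `X ⬝ Yᵢ X^⊥` vanishes only if `X^⊥` is an eigenvector of `Aᵢ`. As `A₁` and `A₂` have no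
common one, compactness bounds one of the two forms below, uniformly in `X`.
-/

open scoped Matrix

namespace PLC

section RecurrentDivisibility

open scoped Polynomial

theorem exists_one_add_sq_mul_pow_prime_pow {R : Type*} [CommRing R] (p : ℕ) (y : R) (k : ℕ) :
    ∃ u : R, (1 + (p : R) ^ 2 * y) ^ p ^ k = 1 + (p : R) ^ (k + 2) * y * (1 + p * u) := by
  induction k with
  | zero => exact ⟨0, by simp⟩
  | succ k ih =>
    obtain ⟨u, hu⟩ := ih
    obtain ⟨s, hs⟩ := Polynomial.powAddExpansion 1 ((p : R) ^ (k + 2) * y * (1 + p * u)) p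
    refine ⟨u + (p : R) ^ k * y * (1 + p * u) ^ 2 * s, ?_⟩
    rw [pow_succ p k, pow_mul, hu, hs, one_pow, one_pow]
    ring

theorem exists_one_add_sq_mul_pow_add_prime_pow {R : Type*} [CommRing R] (p : ℕ) (y : R)
    (n k : ℕ) :
    ∃ u : R, (1 + (p : R) ^ 2 * y) ^ (n + p ^ k) =
      (1 + (p : R) ^ 2 * y) ^ n + (p : R) ^ (k + 2) * y * (1 + p * u) := by
  obtain ⟨u, hu⟩ := exists_one_add_sq_mul_pow_prime_pow p y k
  obtain ⟨s, hs⟩ : (p : R) ∣ (1 + (p : R) ^ 2 * y) ^ n - 1 :=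
    (Dvd.intro (p * y) (by ring)).trans (sub_one_dvd_pow_sub_one (1 + (p : R) ^ 2 * y) n)
  refine ⟨s + u + p * s * u, ?_⟩
  rw [pow_add, hu]
  linear_combination (p : R) ^ (k + 2) * y * (1 + p * u) * hs

theorem exists_aeval_eq_smul_one_add_smul {R : Type*} [CommRing R] [Nontrivial R]
    (Y : Matrix (Fin 2) (Fin 2) R) (q : R[X]) :
    ∃ a b : R, Polynomial.aeval Y q = a • 1 + b • Y := by
  have hdeg : (q %ₘ Y.charpoly).natDegree ≤ 1 :=
    Nat.lt_succ_iff.mp <| by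
      simpa using Polynomial.natDegree_modByMonic_lt q Y.charpoly_monic
        (fun h => by simpa [h] using Y.charpoly_natDegree_eq_dim)
  obtain ⟨b, a, h⟩ := Polynomial.exists_eq_X_add_C_of_natDegree_le_one hdeg
  exact ⟨a, b, by simp [Y.aeval_eq_aeval_mod_charpoly q, h, Algebra.smul_def, add_comm]⟩

theorem dvd_dotProduct_aeval_mulVec {R : Type*} [CommRing R] [Nontrivial R]
    {Y : Matrix (Fin 2) (Fin 2) R} {d : R} {X v : Fin 2 → R} (h₀ : d ∣ X ⬝ᵥ v)
    (h₁ : d ∣ X ⬝ᵥ Y *ᵥ v) (q : R[X]) : d ∣ X ⬝ᵥ Polynomial.aeval Y q *ᵥ v := by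
  obtain ⟨a, b, h⟩ := exists_aeval_eq_smul_one_add_smul Y q
  rw [h, Matrix.add_mulVec, Matrix.smul_mulVec, Matrix.smul_mulVec, Matrix.one_mulVec,
    dotProduct_add, dotProduct_smul, dotProduct_smul]
  exact dvd_add (h₀.mul_left a) (h₁.mul_left b)

theorem exists_dotProduct_one_add_sq_smul_pow_add_prime_pow {R : Type*} [CommRing R]
    [Nontrivial R] (p : ℕ) {Y : Matrix (Fin 2) (Fin 2) R} {X v : Fin 2 → R}
    (h : X ⬝ᵥ Y *ᵥ v ∣ X ⬝ᵥ v) (n k : ℕ) :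
    ∃ u : R, X ⬝ᵥ (1 + (p : R) ^ 2 • Y) ^ (n + p ^ k) *ᵥ v =
      X ⬝ᵥ (1 + (p : R) ^ 2 • Y) ^ n *ᵥ v +
        (p : R) ^ 2 * (X ⬝ᵥ Y *ᵥ v) * (p : R) ^ k * (1 + p * u) := by
  obtain ⟨q, hq⟩ := exists_one_add_sq_mul_pow_add_prime_pow p (Polynomial.X : R[X]) n k
  obtain ⟨u, hu⟩ := dvd_dotProduct_aeval_mulVec h dvd_rfl (Polynomial.X * q)
  have hpow (m : ℕ) : (1 + (p : R) ^ 2 • Y) ^ m =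
      Polynomial.aeval Y ((1 + (p : R[X]) ^ 2 * Polynomial.X) ^ m) := by
    simp [Algebra.smul_def]
  have hcoe : (p : R[X]) ^ (k + 2) * Polynomial.X * (1 + (p : R[X]) * q) =
      ((p : R) ^ (k + 2)) • (Polynomial.X + (p : R) • (Polynomial.X * q)) := by
    simp only [Polynomial.smul_eq_C_mul, map_pow, map_natCast]
    ring
  refine ⟨u, ?_⟩
  rw [hpow, hpow, hq, hcoe, map_add, map_smul, map_add, map_smul, Polynomial.aeval_X,
    Matrix.add_mulVec, Matrix.smul_mulVec, Matrix.add_mulVec, Matrix.smul_mulVec, dotProduct_add,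
    dotProduct_smul, dotProduct_add, dotProduct_smul, hu, smul_eq_mul, smul_eq_mul]
  ring

variable {p : ℕ} [Fact p.Prime]

theorem exists_prime_dvd_add_natCast (a : ℤ_[p]) : ∃ j : ℕ, (p : ℤ_[p]) ∣ a + j := by
  obtain ⟨j, -, hj⟩ := PadicInt.exists_mem_range (-a)
  rw [PadicInt.maximalIdeal_eq_span_p, Ideal.mem_span_singleton] at hj
  exact ⟨j, (dvd_neg.mpr hj).trans (dvd_of_eq (by ring))⟩

theorem exists_pos_mul_prime_pow_dvd {F : ℕ → ℤ_[p]} {c : ℤ_[p]} (h₀ : c ∣ F 0)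
    (hF : ∀ n k, ∃ u : ℤ_[p], F (n + p ^ k) = F n + c * (p : ℤ_[p]) ^ k * (1 + p * u)) (k : ℕ) :
    ∃ n, 0 < n ∧ c * (p : ℤ_[p]) ^ k ∣ F n := by
  induction k with
  | zero =>
    obtain ⟨u, hu⟩ := hF 0 0
    rw [pow_zero, pow_zero, zero_add, mul_one] at hu
    exact ⟨1, one_pos, by simpa [hu] using dvd_add h₀ (dvd_mul_right c _)⟩
  | succ k ih =>
    obtain ⟨n, hn, a, ha⟩ := ih
    have hstep (j : ℕ) : ∃ u : ℤ_[p],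
        F (n + j * p ^ k) = F n + c * (p : ℤ_[p]) ^ k * (j + p * u) := by
      induction j with
      | zero => exact ⟨0, by simp⟩
      | succ j ihj =>
        obtain ⟨u, hu⟩ := ihj
        obtain ⟨u', hu'⟩ := hF (n + j * p ^ k) k
        refine ⟨u + u', ?_⟩
        rw [add_mul, one_mul, ← add_assoc, hu', hu]
        push_cast
        ring
    obtain ⟨j, b, hb⟩ := exists_prime_dvd_add_natCast a
    obtain ⟨u, hu⟩ := hstep j
    refine ⟨n + j * p ^ k, by positivity, b + u, ?_⟩
    rw [hu, ha]
    linear_combination c * (p : ℤ_[p]) ^ k * hb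

theorem exists_pos_prime_pow_dvd_dotProduct_pow_mulVec {Y : Matrix (Fin 2) (Fin 2) ℤ_[p]}
    {X v : Fin 2 → ℤ_[p]} (h : (p : ℤ_[p]) ^ 2 * (X ⬝ᵥ Y *ᵥ v) ∣ X ⬝ᵥ v) (k : ℕ) :
    ∃ n, 0 < n ∧ (p : ℤ_[p]) ^ k ∣ X ⬝ᵥ (1 + (p : ℤ_[p]) ^ 2 • Y) ^ n *ᵥ v := by
  obtain ⟨n, hn, hdvd⟩ := exists_pos_mul_prime_pow_dvd
    (F := fun n => X ⬝ᵥ (1 + (p : ℤ_[p]) ^ 2 • Y) ^ n *ᵥ v) (by simpa using h)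
    (exists_dotProduct_one_add_sq_smul_pow_add_prime_pow p (dvd_of_mul_left_dvd h)) k
  exact ⟨n, hn, dvd_of_mul_left_dvd hdvd⟩

end RecurrentDivisibility

section EigenForm

variable {R : Type*} [CommRing R]

/-- The vector `X` turned by a right angle. It spans the linear relations with coefficients in `R`
satisfied by `X`, as soon as `X` is primitive. -/
def perp (X : Fin 2 → R) : Fin 2 → R := ![-X 1, X 0]

/-- The binary quadratic form attached to a `2 × 2` matrix `Y`. It vanishes at a primitive vector
`X` exactly when `perp X` is an eigenvector of `Y`. -/
def eigenForm (Y : Matrix (Fin 2) (Fin 2) R) (X : Fin 2 → R) : R := X ⬝ᵥ Y *ᵥ perp X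

/-- The vectors that are homogeneous coordinates of a point of the projective line over a local
ring `R`: some entry is a unit. -/
def IsPrimitive (X : Fin 2 → R) : Prop := ∃ i, IsUnit (X i)

theorem dotProduct_perp (X : Fin 2 → R) : X ⬝ᵥ perp X = 0 := by
  simp only [perp, dotProduct, Fin.sum_univ_two, Matrix.cons_val_zero, Matrix.cons_val_one]
  ring

theorem eigenForm_eq (Y : Matrix (Fin 2) (Fin 2) R) (X : Fin 2 → R) :
    eigenForm Y X = Y 0 1 * X 0 ^ 2 + (Y 1 1 - Y 0 0) * (X 0 * X 1) - Y 1 0 * X 1 ^ 2 := by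
  simp only [eigenForm, perp, Matrix.mulVec, dotProduct, Fin.sum_univ_two, Matrix.cons_val_zero,
    Matrix.cons_val_one]
  ring

theorem eigenForm_one_add_smul (a : R) (Y : Matrix (Fin 2) (Fin 2) R) (X : Fin 2 → R) :
    eigenForm (1 + a • Y) X = a * eigenForm Y X := by
  rw [eigenForm, Matrix.add_mulVec, Matrix.one_mulVec, Matrix.smul_mulVec, dotProduct_add,
    dotProduct_perp, dotProduct_smul, zero_add, smul_eq_mul, ← eigenForm]

theorem eigenForm_eq_zero_of_commute [IsDomain R] {A Y : Matrix (Fin 2) (Fin 2) R}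
    (hAY : Commute A Y) (hY : Y ∉ Set.range (Matrix.scalar (Fin 2))) {X : Fin 2 → R}
    (h : eigenForm Y X = 0) : eigenForm A X = 0 := by
  have hcomm (i j : Fin 2) : (A * Y) i j = (Y * A) i j := by rw [hAY.eq]
  simp only [Matrix.mul_apply, Fin.sum_univ_two] at hcomm
  have h₀₁ : Y 0 1 * eigenForm A X = A 0 1 * eigenForm Y X := by
    rw [eigenForm_eq, eigenForm_eq]
    linear_combination -(X 0 * X 1) * hcomm 0 1 + X 1 ^ 2 * hcomm 0 0
  have h₁₀ : Y 1 0 * eigenForm A X = A 1 0 * eigenForm Y X := by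
    rw [eigenForm_eq, eigenForm_eq]
    linear_combination X 0 * X 1 * hcomm 1 0 + X 0 ^ 2 * hcomm 0 0
  have h₁₁ : (Y 1 1 - Y 0 0) * eigenForm A X = (A 1 1 - A 0 0) * eigenForm Y X := by
    rw [eigenForm_eq, eigenForm_eq]
    linear_combination X 0 ^ 2 * hcomm 0 1 + X 1 ^ 2 * hcomm 1 0
  by_contra hA
  simp only [h, mul_zero, mul_eq_zero, hA, or_false] at h₀₁ h₁₀ h₁₁
  refine hY ⟨Y 0 0, ?_⟩
  ext i j
  fin_cases i <;> fin_cases j <;> simp [h₀₁, h₁₀, sub_eq_zero.mp h₁₁]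

namespace IsPrimitive

variable {X : Fin 2 → R}

protected theorem perp (hX : IsPrimitive X) : IsPrimitive (perp X) := by
  obtain ⟨i, hi⟩ := hX
  fin_cases i
  exacts [⟨1, hi⟩, ⟨0, hi.neg⟩]

theorem ne_zero [Nontrivial R] (hX : IsPrimitive X) : X ≠ 0 := by
  rintro rfl
  exact not_isUnit_zero hX.choose_spec

theorem exists_eq_smul_perp (hX : IsPrimitive X) {u : Fin 2 → R} (h : X ⬝ᵥ u = 0) :
    ∃ μ : R, u = μ • perp X := by
  simp only [dotProduct, Fin.sum_univ_two] at h
  rcases Fin.exists_fin_two.mp hX with hi | hi <;> obtain ⟨a, ha⟩ := hi.exists_left_inv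
  · refine ⟨a * u 1, funext (Fin.forall_fin_two.mpr ⟨?_, ?_⟩)⟩ <;>
      simp only [perp, Pi.smul_apply, smul_eq_mul, Matrix.cons_val_zero, Matrix.cons_val_one]
    · linear_combination a * h - u 0 * ha
    · linear_combination -u 1 * ha
  · refine ⟨-(a * u 0), funext (Fin.forall_fin_two.mpr ⟨?_, ?_⟩)⟩ <;>
      simp only [perp, Pi.smul_apply, smul_eq_mul, Matrix.cons_val_zero, Matrix.cons_val_one]
    · linear_combination -u 0 * ha
    · linear_combination a * h - u 1 * ha

theorem vecMul [IsLocalRing R] (hX : IsPrimitive X) {M : Matrix (Fin 2) (Fin 2) R}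
    (hM : IsUnit M) : IsPrimitive (X ᵥ* M) := by
  obtain ⟨i, hi⟩ := hX
  obtain ⟨M, rfl⟩ := hM
  have h : X = (X ᵥ* M.val) ᵥ* M⁻¹.val := by simp [Matrix.vecMul_vecMul]
  rw [h, Matrix.vecMul, dotProduct] at hi
  obtain ⟨j, -, hj⟩ := IsLocalRing.exists_of_isUnit_sum hi
  exact ⟨j, isUnit_of_mul_isUnit_left hj⟩

end IsPrimitive

end EigenForm

section Transversality

variable {p : ℕ} [Fact p.Prime]

theorem dvd_of_norm_le {a b : ℤ_[p]} (h : ‖b‖ ≤ ‖a‖) : a ∣ b := by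
  by_cases ha : a = 0
  · rw [ha, norm_zero, norm_le_zero_iff] at h
    rw [h]
    exact dvd_zero a
  · have hle : ‖(b : ℚ_[p]) / a‖ ≤ 1 := by
      rw [norm_div]
      exact div_le_one_of_le₀ h (norm_nonneg _)
    exact ⟨⟨b / a, hle⟩, PadicInt.ext (mul_div_cancel₀ _ (PadicInt.coe_ne_zero.mpr ha)).symm⟩

theorem isClosed_setOf_isPrimitive : IsClosed {X : Fin 2 → ℤ_[p] | IsPrimitive X} := by
  simp only [IsPrimitive, PadicInt.isUnit_iff, Set.ofPred_exists]
  exact isClosed_iUnion_of_finite fun i =>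
    isClosed_eq (continuous_apply i).norm continuous_const

theorem continuous_eigenForm (Y : Matrix (Fin 2) (Fin 2) ℤ_[p]) : Continuous (eigenForm Y) := by
  simp only [funext (eigenForm_eq Y)]
  fun_prop

theorem exists_forall_eigenForm_dvd {Y₁ Y₂ : Matrix (Fin 2) (Fin 2) ℤ_[p]}
    (h : ∀ X, IsPrimitive X → eigenForm Y₁ X = 0 → eigenForm Y₂ X ≠ 0) :
    ∃ L : ℕ, ∀ X, IsPrimitive X →
      eigenForm Y₁ X ∣ (p : ℤ_[p]) ^ L ∨ eigenForm Y₂ X ∣ (p : ℤ_[p]) ^ L := by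
  let f (X : Fin 2 → ℤ_[p]) : ℝ := max ‖eigenForm Y₁ X‖ ‖eigenForm Y₂ X‖
  have hf : Continuous f := (continuous_eigenForm Y₁).norm.max (continuous_eigenForm Y₂).norm
  obtain ⟨X₀, hX₀, hmin⟩ := isClosed_setOf_isPrimitive.isCompact.exists_isMinOn
    ⟨fun _ => 1, 0, isUnit_one⟩ hf.continuousOn
  have hpos : 0 < f X₀ := by
    by_cases h₁ : eigenForm Y₁ X₀ = 0
    · exact lt_max_of_lt_right (norm_pos_iff.mpr (h X₀ hX₀ h₁))
    · exact lt_max_of_lt_left (norm_pos_iff.mpr h₁)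
  obtain ⟨L, hL⟩ := PadicInt.exists_pow_neg_lt p hpos
  refine ⟨L, fun X hX => ?_⟩
  have hle : ‖(p : ℤ_[p]) ^ L‖ ≤ f X := by
    rw [PadicInt.norm_p_pow]
    exact hL.le.trans (hmin hX)
  exact (le_max_iff.mp hle).imp dvd_of_norm_le dvd_of_norm_le

end Transversality

section IntegerVector

variable {p : ℕ} [Fact p.Prime]

theorem exists_intCast_comp_eq_add_smul {ι : Type*} (x : ι → ℤ_[p]) (S : ℕ) :
    ∃ v : ι → ℤ, (∀ i, |v i| ≤ (p : ℤ) ^ S) ∧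
      ∃ z : ι → ℤ_[p], Int.cast ∘ v = x + (p : ℤ_[p]) ^ S • z := by
  choose z hz using fun i => Ideal.mem_span_singleton.mp (PadicInt.appr_spec S (x i))
  refine ⟨fun i => (x i).appr S, fun i => ?_, -z, funext fun i => ?_⟩
  · rw [Nat.abs_cast]
    exact_mod_cast ((x i).appr_lt S).le
  · simp only [Function.comp_apply, Int.cast_natCast, Pi.add_apply, Pi.smul_apply, Pi.neg_apply,
      smul_eq_mul]
    linear_combination -hz i

theorem isUnit_one_add_prime_mul (a : ℤ_[p]) : IsUnit (1 + (p : ℤ_[p]) * a) := by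
  rw [← sub_neg_eq_add]
  refine IsLocalRing.isUnit_one_sub_self_of_mem_nonunits _ fun h => ?_
  exact PadicInt.prime_p.not_isUnit (isUnit_of_mul_isUnit_left ((IsUnit.neg_iff _).mp h))

theorem sq_mul_dotProduct_mulVec_dvd {Y : Matrix (Fin 2) (Fin 2) ℤ_[p]} {X : Fin 2 → ℤ_[p]}
    {L : ℕ} (hL : eigenForm Y X ∣ (p : ℤ_[p]) ^ L) (z : Fin 2 → ℤ_[p]) :
    (p : ℤ_[p]) ^ 2 * (X ⬝ᵥ Y *ᵥ (perp X + (p : ℤ_[p]) ^ (L + 2) • z)) ∣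
      X ⬝ᵥ (perp X + (p : ℤ_[p]) ^ (L + 2) • z) := by
  obtain ⟨u, hu⟩ := id hL
  set r := X ⬝ᵥ Y *ᵥ z with hr
  have hunit : IsUnit (1 + (p : ℤ_[p]) ^ 2 * (u * r)) := by
    rw [sq, mul_assoc]
    exact isUnit_one_add_prime_mul _
  have hform : X ⬝ᵥ Y *ᵥ (perp X + (p : ℤ_[p]) ^ (L + 2) • z) =
      eigenForm Y X * (1 + (p : ℤ_[p]) ^ 2 * (u * r)) := by
    rw [Matrix.mulVec_add, Matrix.mulVec_smul, dotProduct_add, dotProduct_smul, smul_eq_mul,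
      ← eigenForm, ← hr]
    linear_combination (p : ℤ_[p]) ^ 2 * r * hu
  rw [hform, dotProduct_add, dotProduct_perp, dotProduct_smul, zero_add, smul_eq_mul, pow_add,
    mul_comm ((p : ℤ_[p]) ^ L), mul_assoc]
  exact mul_dvd_mul_left _ ((hunit.mul_right_dvd.mpr hL).mul_right _)

theorem exists_int_vector_forall_prime_pow_dvd {A Y : Matrix (Fin 2) (Fin 2) ℤ_[p]} {M : ℕ}
    (hM : 0 < M) (hY : A ^ M = 1 + (p : ℤ_[p]) ^ 2 • Y) {X : Fin 2 → ℤ_[p]} (hX : IsPrimitive X)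
    {L : ℕ} (hL : eigenForm Y X ∣ (p : ℤ_[p]) ^ L) :
    ∃ v : Fin 2 → ℤ, v ≠ 0 ∧ (∀ i, |v i| ≤ (p : ℤ) ^ (L + 2)) ∧
      ∀ k, ∃ t, 0 < t ∧ (p : ℤ_[p]) ^ k ∣ X ⬝ᵥ A ^ t *ᵥ (Int.cast ∘ v) := by
  obtain ⟨v, hv, z, hz⟩ := exists_intCast_comp_eq_add_smul (perp X) (L + 2)
  refine ⟨v, ?_, hv, fun k => ?_⟩
  · rintro rfl
    obtain ⟨i, hi⟩ := hX.perp
    refine PadicInt.prime_p.not_isUnit (isUnit_of_dvd_unit ?_ hi)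
    have hzi := congrFun hz i
    simp only [Function.comp_apply, Pi.zero_apply, Int.cast_zero, Pi.add_apply, Pi.smul_apply,
      smul_eq_mul] at hzi
    exact ⟨-((p : ℤ_[p]) ^ (L + 1) * z i), by linear_combination -hzi⟩
  · have hdvd := sq_mul_dotProduct_mulVec_dvd hL z
    rw [← hz] at hdvd
    obtain ⟨n, hn, hk⟩ := exists_pos_prime_pow_dvd_dotProduct_pow_mulVec hdvd k
    exact ⟨M * n, Nat.mul_pos hM hn, by rwa [pow_mul, hY]⟩

end IntegerVector

section Reduction

variable {p : ℕ} [Fact p.Prime]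

theorem red_eq_mapMatrix (k : ℕ) (A : Matrix (Fin 2) (Fin 2) ℤ_[p]) :
    red p k A = (PadicInt.toZModPow k).mapMatrix A := rfl

theorem red_mapMatrix_intCast (k : ℕ) (M : Matrix (Fin 2) (Fin 2) ℤ) :
    red p k ((Int.castRingHom ℤ_[p]).mapMatrix M) = M.map (Int.castRingHom (ZMod (p ^ k))) := by
  ext i j
  simp [red]

theorem red_eq_red_iff {k : ℕ} {A B : Matrix (Fin 2) (Fin 2) ℤ_[p]} :
    red p k A = red p k B ↔ ∃ Y, A = B + (p : ℤ_[p]) ^ k • Y := by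
  have hentry (i j : Fin 2) : PadicInt.toZModPow k (A i j) = PadicInt.toZModPow k (B i j) ↔
      ∃ y, A i j = B i j + (p : ℤ_[p]) ^ k * y := by
    rw [← sub_eq_zero, ← map_sub, ← RingHom.mem_ker, PadicInt.ker_toZModPow,
      Ideal.mem_span_singleton]
    exact exists_congr fun y => sub_eq_iff_eq_add'
  simp only [← Matrix.ext_iff, red, Matrix.map_apply, hentry, Matrix.add_apply,
    Matrix.smul_apply, smul_eq_mul]
  refine ⟨fun h => ?_, fun ⟨Y, hY⟩ i j => ⟨Y i j, hY i j⟩⟩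
  choose Y hY using h
  exact ⟨Matrix.of Y, hY⟩

theorem prime_pow_dvd_dotProduct_mulVec_of_red_eq {k : ℕ} {A B : Matrix (Fin 2) (Fin 2) ℤ_[p]}
    (h : red p k A = red p k B) {X v : Fin 2 → ℤ_[p]} (hB : (p : ℤ_[p]) ^ k ∣ X ⬝ᵥ B *ᵥ v) :
    (p : ℤ_[p]) ^ k ∣ X ⬝ᵥ A *ᵥ v := by
  obtain ⟨Y, rfl⟩ := red_eq_red_iff.mp h
  rw [Matrix.add_mulVec, Matrix.smul_mulVec, dotProduct_add, dotProduct_smul]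
  exact dvd_add hB (dvd_mul_right _ _)

theorem exists_pow_eq_one_add_smul {A : Matrix (Fin 2) (Fin 2) ℤ_[p]} (hA : IsUnit A.det)
    (k : ℕ) : ∃ M, 0 < M ∧ ∃ Y, A ^ M = 1 + (p : ℤ_[p]) ^ k • Y := by
  have : NeZero (p ^ k) := ⟨pow_ne_zero _ (Fact.out : p.Prime).ne_zero⟩
  obtain ⟨u, hu⟩ := ((Matrix.isUnit_iff_isUnit_det A).mpr hA).map
    (PadicInt.toZModPow (p := p) k).mapMatrix
  obtain ⟨M, hM, hMu⟩ := (isOfFinOrder_of_finite u).exists_pow_eq_one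
  refine ⟨M, hM, red_eq_red_iff.mp ?_⟩
  rw [red_eq_mapMatrix, red_eq_mapMatrix, map_pow, map_one, ← hu, ← Units.val_pow_eq_pow_val,
    hMu, Units.val_one]

theorem exists_forall_red_ne {A B : Matrix (Fin 2) (Fin 2) ℤ_[p]} (hAB : A ≠ B) :
    ∃ k₀, ∀ k, k₀ ≤ k → red p k A ≠ red p k B := by
  obtain ⟨i, j, hij⟩ : ∃ i j, A i j - B i j ≠ 0 := by
    by_contra! h
    exact hAB (Matrix.ext fun i j => sub_eq_zero.mp (h i j))
  obtain ⟨n, hn⟩ := FiniteMultiplicity.of_prime_left PadicInt.prime_p hij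
  refine ⟨n + 1, fun k hk h => hn ((pow_dvd_pow _ hk).trans ?_)⟩
  obtain ⟨Y, rfl⟩ := red_eq_red_iff.mp h
  exact ⟨Y i j, by simp⟩

end Reduction

section Words

theorem shift_iterate_apply (w : ℕ → ℕ) (m i : ℕ) : shift^[m] w i = w (m + i) := by
  induction m generalizing i with
  | zero => rw [Function.iterate_zero_apply, zero_add]
  | succ m ih => rw [Function.iterate_succ_apply', shift, ih, add_right_comm, add_assoc]

theorem pre_succ (w : ℕ → ℕ) (n : ℕ) : pre w (n + 1) = w 0 :: pre (shift w) n := by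
  simp [pre, List.range_succ_eq_map, shift]

theorem pre_add (w : ℕ → ℕ) (m n : ℕ) : pre w (m + n) = pre w m ++ pre (shift^[m] w) n := by
  simp [pre, List.range_add, Function.comp_def, shift_iterate_apply]

theorem wordMatrix_cons (a : ℕ) (l : List ℕ) :
    wordMatrix (a :: l) = letterMatrix a * wordMatrix l := by
  simp [wordMatrix]

theorem isUnit_letterMatrix (a : ℕ) : IsUnit (letterMatrix a) := by
  simp [Matrix.isUnit_iff_isUnit_det, letterMatrix, Matrix.det_fin_two]

theorem isUnit_wordMatrix (l : List ℕ) : IsUnit (wordMatrix l) := by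
  induction l with
  | nil => exact isUnit_one
  | cons a l ih => exact wordMatrix_cons a l ▸ (isUnit_letterMatrix a).mul ih

theorem pre_shift_add_and_wordMatrix_pre_add {w : ℕ → ℕ} {m m' n : ℕ}
    (hm : pre (shift^[m] w) (m' + n) = pre w (m' + n)) (hm' : pre (shift^[m'] w) n = pre w n) :
    pre (shift^[m + m'] w) n = pre w n ∧
      wordMatrix (pre w (m + m')) = wordMatrix (pre w m) * wordMatrix (pre w m') := by
  rw [pre_add, pre_add w] at hm
  obtain ⟨hhead, htail⟩ := List.append_inj hm (by simp [pre])
  refine ⟨?_, ?_⟩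
  · rw [add_comm, Function.iterate_add_apply, htail, hm']
  · rw [pre_add, hhead, wordMatrix, List.map_append, List.prod_append, ← wordMatrix, ← wordMatrix]

/-- The matrices modulo `p ^ k` that are reductions of return matrices of `w` to its prefix of
length `n`, for every `n`. -/
def recurrentSubmonoid (p k : ℕ) (w : ℕ → ℕ) :
    Submonoid (Matrix (Fin 2) (Fin 2) (ZMod (p ^ k))) where
  carrier := {A | ∀ n, A ∈ Vmod p k n w}
  one_mem' _ := ⟨1, ⟨0, rfl, rfl⟩, by simp⟩
  mul_mem' {A B} hA hB n := by
    obtain ⟨_, ⟨m', hm', rfl⟩, rfl⟩ := hB n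
    obtain ⟨_, ⟨m, hm, rfl⟩, rfl⟩ := hA (m' + n)
    obtain ⟨hpre, hmul⟩ := pre_shift_add_and_wordMatrix_pre_add hm hm'
    exact ⟨_, ⟨m + m', hpre, rfl⟩, by simp only [hmul, Matrix.map_mul]⟩

theorem exists_pos_wordMatrix_eq_pow {p k : ℕ} {w : ℕ → ℕ}
    {A : Matrix (Fin 2) (Fin 2) (ZMod (p ^ k))} (hA : A ∈ recurrentSubmonoid p k w) (hA₁ : A ≠ 1)
    {t : ℕ} (ht : 0 < t) :
    ∃ m, 0 < m ∧ (wordMatrix (pre w m)).map (Int.castRingHom (ZMod (p ^ k))) = A ^ t := by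
  obtain ⟨t, rfl⟩ := Nat.exists_eq_add_one.mpr ht
  obtain ⟨_, ⟨m', hm', rfl⟩, hmat'⟩ := pow_mem hA t 0
  obtain ⟨_, ⟨m, hm, rfl⟩, hmat⟩ := hA (m' + 0)
  refine ⟨m + m', Nat.add_pos_left (Nat.pos_of_ne_zero ?_) m', ?_⟩
  · rintro rfl
    exact hA₁ (hmat.symm.trans (by simp [pre, wordMatrix]))
  · rw [(pre_shift_add_and_wordMatrix_pre_add hm hm').2, Matrix.map_mul, pow_succ']
    exact congrArg₂ (· * ·) hmat hmat'

end Words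

section Orbit

variable {p : ℕ} [Fact p.Prime]

/-- The point of the projective line over `ℚ_p` with primitive `p`-adic integral coordinates
`X`. -/
noncomputable def integralPoint (X : Fin 2 → ℤ_[p]) (hX : IsPrimitive X) : Line p :=
  Projectivization.mk ℚ_[p] (fun i => (X i : ℚ_[p])) fun h =>
    hX.ne_zero (funext fun i => PadicInt.coe_eq_zero.mp (congrFun h i))

theorem exists_eq_integralPoint (x : Line p) : ∃ X hX, x = integralPoint X hX := by
  obtain ⟨j, hj⟩ := Finite.exists_max fun i => ‖x.rep i‖
  have hj₀ : x.rep j ≠ 0 := fun h₀ =>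
    x.rep_nonzero (funext fun i => norm_le_zero_iff.mp (by simpa [h₀] using hj i))
  have hle (i : Fin 2) : ‖x.rep i / x.rep j‖ ≤ 1 := by
    rw [norm_div]
    exact div_le_one_of_le₀ (hj i) (norm_nonneg _)
  let X (i : Fin 2) : ℤ_[p] := ⟨x.rep i / x.rep j, hle i⟩
  have hXj : X j = 1 := PadicInt.ext (div_self hj₀)
  refine ⟨X, ⟨j, hXj ▸ isUnit_one⟩, ?_⟩
  nth_rw 1 [← x.mk_rep]
  exact (Projectivization.mk_eq_mk_iff' ..).mpr
    ⟨x.rep j, funext fun i => mul_div_cancel₀ _ hj₀⟩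

theorem letterAct_integralPoint (a : ℕ) {X : Fin 2 → ℤ_[p]} (hX : IsPrimitive X) :
    letterAct p a (integralPoint X hX) =
      integralPoint (X ᵥ* (Int.castRingHom ℤ_[p]).mapMatrix (letterMatrix a))
        (hX.vecMul ((isUnit_letterMatrix a).map _)) := by
  rw [letterAct, integralPoint, Projectivization.map_mk, integralPoint]
  congr 1
  ext i
  fin_cases i <;>
    simp [letterMatrixQ, letterMatrix, Matrix.vecMul, dotProduct, Fin.sum_univ_two, mul_comm]

theorem T_iterate_integralPoint (w : ℕ → ℕ) {X : Fin 2 → ℤ_[p]} (hX : IsPrimitive X) (m : ℕ) :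
    (T p)^[m] (w, integralPoint X hX) = (shift^[m] w,
      integralPoint (X ᵥ* (Int.castRingHom ℤ_[p]).mapMatrix (wordMatrix (pre w m)))
        (hX.vecMul ((isUnit_wordMatrix _).map _))) := by
  induction m generalizing w X with
  | zero => simp [pre, wordMatrix]
  | succ m ih =>
    simp only [Function.iterate_succ_apply, T, letterAct_integralPoint, ih, pre_succ,
      wordMatrix_cons, map_mul, Matrix.vecMul_vecMul]

theorem le_of_badVec {ε : ℝ} {X : Fin 2 → ℤ_[p]} (hX : IsPrimitive X)
    (hbad : BadVec p ε fun i => (X i : ℚ_[p])) {v : Fin 2 → ℤ} (hv : v ≠ 0) {C : ℤ}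
    (hC : ∀ i, |v i| ≤ C) {k : ℕ} (hk : (p : ℤ_[p]) ^ k ∣ X ⬝ᵥ (Int.cast ∘ v)) :
    ε ≤ (C : ℝ) ^ 2 * ((p : ℝ) ^ k)⁻¹ := by
  have hv' : (v 0, v 1) ≠ (0, 0) := fun h =>
    hv (funext (Fin.forall_fin_two.mpr (Prod.mk.inj h)))
  have hnorm : ‖(v 0 : ℚ_[p]) * X 0 + (v 1 : ℚ_[p]) * X 1‖ ≤ ((p : ℝ) ^ k)⁻¹ := by
    have h := (PadicInt.norm_le_pow_iff_mem_span_pow _ k).mpr (Ideal.mem_span_singleton.mpr hk)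
    rw [zpow_neg, zpow_natCast, PadicInt.norm_def] at h
    simpa [dotProduct, Fin.sum_univ_two, mul_comm] using h
  have hone : 1 ≤ max ‖(X 0 : ℚ_[p])‖ ‖(X 1 : ℚ_[p])‖ := by
    simp only [← PadicInt.norm_def, le_max_iff]
    exact (Fin.exists_fin_two.mp hX).imp (fun h => (PadicInt.isUnit_iff.mp h).ge)
      fun h => (PadicInt.isUnit_iff.mp h).ge
  set D := max |(v 0 : ℝ)| |(v 1 : ℝ)| with hD
  have hD₀ : 0 < D := by
    rw [hD, lt_max_iff, abs_pos, abs_pos]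
    by_contra! h
    exact hv' (Prod.ext (by exact_mod_cast h.1) (by exact_mod_cast h.2))
  have hDC : D ≤ C := max_le (by exact_mod_cast hC 0) (by exact_mod_cast hC 1)
  have hle : (D ^ 2)⁻¹ * ε ≤ ((p : ℝ) ^ k)⁻¹ :=
    (hbad _ _ hv').trans <|
      (mul_le_of_le_one_right (norm_nonneg _) (inv_le_one_of_one_le₀ hone)).trans hnorm
  calc ε ≤ D ^ 2 * ((p : ℝ) ^ k)⁻¹ := (inv_mul_le_iff₀ (by positivity)).mp hle
    _ ≤ (C : ℝ) ^ 2 * ((p : ℝ) ^ k)⁻¹ := by gcongr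

theorem le_of_mem_LMad {ε : ℝ} {w : ℕ → ℕ} {X : Fin 2 → ℤ_[p]} {hX : IsPrimitive X}
    (hmem : (w, integralPoint X hX) ∈ LMad p ε) {m : ℕ} (hm : 0 < m) {v : Fin 2 → ℤ}
    (hv : v ≠ 0) {C : ℤ} (hC : ∀ i, |v i| ≤ C) {k : ℕ}
    (hk : (p : ℤ_[p]) ^ k ∣
      X ⬝ᵥ (Int.castRingHom ℤ_[p]).mapMatrix (wordMatrix (pre w m)) *ᵥ (Int.cast ∘ v)) :
    ε ≤ (C : ℝ) ^ 2 * ((p : ℝ) ^ k)⁻¹ := by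
  have hbad := (hmem m hm).2
  rw [T_iterate_integralPoint, integralPoint, mk_mem_PBad] at hbad
  refine le_of_badVec (hX.vecMul ((isUnit_wordMatrix _).map _)) hbad hv hC ?_
  rwa [← Matrix.dotProduct_mulVec]

theorem le_one_of_mem_LMad {ε : ℝ} {w : ℕ → ℕ} {x : Line p} (hmem : (w, x) ∈ LMad p ε) :
    ε ≤ 1 := by
  obtain ⟨X, hX, rfl⟩ := exists_eq_integralPoint x
  simpa using le_of_mem_LMad hmem one_pos (v := ![1, 0]) (by simp) (C := 1)
    (by simp [Fin.forall_fin_two]) (k := 0) (by simp)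

end Orbit

section Recurrence

variable {p : ℕ} [Fact p.Prime]

theorem le_of_mem_LMad_of_mem_recurrentSubmonoid {A Y : Matrix (Fin 2) (Fin 2) ℤ_[p]} {M : ℕ}
    (hM : 0 < M) (hY : A ^ M = 1 + (p : ℤ_[p]) ^ 2 • Y) {w : ℕ → ℕ} {k : ℕ}
    (hA : red p k A ∈ recurrentSubmonoid p k w) (hA₁ : red p k A ≠ red p k 1)
    {X : Fin 2 → ℤ_[p]} {hX : IsPrimitive X} {L : ℕ} (hL : eigenForm Y X ∣ (p : ℤ_[p]) ^ L)
    {ε : ℝ} (hmem : (w, integralPoint X hX) ∈ LMad p ε) :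
    ε ≤ (p : ℝ) ^ (2 * (L + 2)) * ((p : ℝ) ^ k)⁻¹ := by
  obtain ⟨v, hv, hvC, hdvd⟩ := exists_int_vector_forall_prime_pow_dvd hM hY hX hL
  obtain ⟨t, ht, hdvd⟩ := hdvd k
  rw [red_eq_mapMatrix k 1, map_one] at hA₁
  obtain ⟨m, hm, hmat⟩ := exists_pos_wordMatrix_eq_pow hA hA₁ ht
  have hred : red p k ((Int.castRingHom ℤ_[p]).mapMatrix (wordMatrix (pre w m))) =
      red p k (A ^ t) := by
    rw [red_mapMatrix_intCast, hmat, red_eq_mapMatrix, red_eq_mapMatrix, map_pow]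
  have h := le_of_mem_LMad hmem hm hv hvC (prime_pow_dvd_dotProduct_mulVec_of_red_eq hred hdvd)
  simpa [pow_mul, pow_right_comm] using h

theorem exists_mulVec_perp_eq_smul {A Y : Matrix (Fin 2) (Fin 2) ℤ_[p]} {M : ℕ} {a : ℤ_[p]}
    (hY : A ^ M = 1 + a • Y) (hA : A ^ M ∉ Set.range (Matrix.scalar (Fin 2)))
    {X : Fin 2 → ℤ_[p]} (hX : IsPrimitive X) (h : eigenForm Y X = 0) :
    ∃ μ : ℤ_[p], A *ᵥ perp X = μ • perp X := by
  refine hX.exists_eq_smul_perp (eigenForm_eq_zero_of_commute (.self_pow A M) hA ?_)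
  rw [hY, eigenForm_one_add_smul, h, mul_zero]

theorem exists_forall_lt_of_mem_LMad {A Y : Matrix (Fin 2) (Fin 2) ℤ_[p]} {M : ℕ} (hM : 0 < M)
    (hY : A ^ M = 1 + (p : ℤ_[p]) ^ 2 • Y) (hA : A ≠ 1) (L : ℕ) :
    ∃ c : ℝ, 0 < c ∧ ∀ (w : ℕ → ℕ) (k : ℕ), red p k A ∈ recurrentSubmonoid p k w →
      ∀ (X : Fin 2 → ℤ_[p]) (hX : IsPrimitive X), eigenForm Y X ∣ (p : ℤ_[p]) ^ L →
        ∀ ε, (w, integralPoint X hX) ∈ LMad p ε → ε < c * ((p : ℝ) ^ k)⁻¹ := by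
  have hp : 0 < (p : ℝ) := by exact_mod_cast (Fact.out : p.Prime).pos
  obtain ⟨k₀, hk₀⟩ := exists_forall_red_ne hA
  refine ⟨(p : ℝ) ^ (2 * (L + 2)) + (p : ℝ) ^ k₀, by positivity,
    fun w k hw X hX hL ε hmem => ?_⟩
  rcases le_or_gt k₀ k with hk | hk
  · calc ε ≤ (p : ℝ) ^ (2 * (L + 2)) * ((p : ℝ) ^ k)⁻¹ :=
          le_of_mem_LMad_of_mem_recurrentSubmonoid hM hY hw (hk₀ k hk) hL hmem
      _ < _ := by
        gcongr
        exact lt_add_of_pos_right _ (by positivity)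
  · calc ε ≤ 1 := le_one_of_mem_LMad hmem
      _ = (p : ℝ) ^ k * ((p : ℝ) ^ k)⁻¹ := (mul_inv_cancel₀ (by positivity)).symm
      _ ≤ (p : ℝ) ^ k₀ * ((p : ℝ) ^ k)⁻¹ := by
        gcongr
        exact_mod_cast (Fact.out : p.Prime).one_le
      _ < _ := by
        gcongr
        exact lt_add_of_pos_left _ (by positivity)

end Recurrence

section Log

open Filter Topology

variable {p : ℕ} [Fact p.Prime]

theorem padicComplex_norm_natCast (n : ℕ) : ‖(n : ℂ_[p])‖ = ‖(n : ℚ_[p])‖ := by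
  rw [← PadicComplex.norm_extends' (p := p), map_natCast, PadicComplex.coe_natCast]

theorem norm_inv_natCast_le (n : ℕ) : ‖(n : ℂ_[p])⁻¹‖ ≤ n := by
  rcases n.eq_zero_or_pos with rfl | hn
  · simp
  have hp : 0 < (p : ℝ) := by exact_mod_cast (Fact.out : p.Prime).pos
  have hle : (n : ℝ)⁻¹ ≤ ‖(n : ℚ_[p])‖ := by
    rw [Padic.norm_eq_zpow_neg_valuation (by exact_mod_cast hn.ne'), Padic.valuation_natCast,
      zpow_neg, zpow_natCast]
    exact inv_anti₀ (by positivity) (by exact_mod_cast Nat.le_of_dvd hn pow_padicValNat_dvd)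
  rw [norm_inv, padicComplex_norm_natCast]
  exact inv_le_of_inv_le₀ (by exact_mod_cast hn) hle

theorem tendsto_prime_pow : Tendsto (fun j : ℕ => (p : ℂ_[p]) ^ j) atTop (𝓝 0) := by
  refine tendsto_pow_atTop_nhds_zero_of_norm_lt_one ?_
  rw [padicComplex_norm_natCast]
  exact Padic.norm_p_lt_one

theorem prime_pow_mul_choose (j m : ℕ) :
    (p : ℂ_[p]) ^ j * (p ^ j - 1).choose m = (p ^ j).choose (m + 1) * (m + 1 : ℕ) := by
  have h := Nat.add_one_mul_choose_eq (p ^ j - 1) m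
  rw [Nat.sub_add_cancel (pow_pos (Fact.out : p.Prime).pos j)] at h
  exact_mod_cast h

theorem tendsto_choose_prime_pow_sub_one (m : ℕ) :
    Tendsto (fun j : ℕ => ((p ^ j - 1).choose m : ℂ_[p])) atTop (𝓝 ((-1) ^ m)) := by
  induction m with
  | zero => simp
  | succ m ih =>
    have hlim := ((tendsto_prime_pow.mul ih).div_const ((m + 1 : ℕ) : ℂ_[p])).sub ih
    rw [zero_mul, zero_div, zero_sub, ← neg_one_mul, ← pow_succ'] at hlim
    refine hlim.congr fun j => ?_
    have hpascal := Nat.choose_succ_succ (p ^ j - 1) m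
    rw [Nat.succ_eq_add_one, Nat.sub_add_cancel (pow_pos (Fact.out : p.Prime).pos j)] at hpascal
    rw [prime_pow_mul_choose, mul_div_cancel_right₀ _ (Nat.cast_ne_zero.mpr m.succ_ne_zero),
      hpascal, Nat.cast_add, add_sub_cancel_left]

theorem tsum_choose_prime_pow_sub_one_mul_pow_div (z : ℂ_[p]) (j : ℕ) :
    ∑' n : ℕ, ((p ^ j - 1).choose n : ℂ_[p]) * z ^ (n + 1) / (n + 1 : ℕ) =
      ((1 + z) ^ p ^ j - 1) / (p : ℂ_[p]) ^ j := by
  have hp : p.Prime := Fact.out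
  rw [tsum_eq_sum (s := Finset.range (p ^ j))]
  · rw [eq_div_iff (pow_ne_zero _ (Nat.cast_ne_zero.mpr hp.ne_zero)), add_comm 1 z, add_pow,
      Finset.sum_range_succ', Finset.sum_mul]
    simp only [one_pow, mul_one, pow_zero, Nat.choose_zero_right, Nat.cast_one,
      add_sub_cancel_right]
    refine Finset.sum_congr rfl fun n _ => ?_
    rw [div_mul_eq_mul_div, div_eq_iff (Nat.cast_ne_zero.mpr n.succ_ne_zero)]
    linear_combination z ^ (n + 1) * prime_pow_mul_choose (p := p) j n
  · intro n hn
    rw [Finset.mem_range, not_lt] at hn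
    rw [Nat.choose_eq_zero_of_lt ((Nat.sub_lt (pow_pos hp.pos j) one_pos).trans_le hn),
      Nat.cast_zero, zero_mul, zero_div]

theorem tendsto_plog {x : ℂ_[p]} (hx : ‖x - 1‖ < 1) :
    Tendsto (fun j : ℕ => (x ^ p ^ j - 1) / (p : ℂ_[p]) ^ j) atTop (𝓝 (plog p x)) := by
  have hsum : Summable fun n : ℕ => ((n + 1 : ℕ) : ℝ) * ‖x - 1‖ ^ (n + 1) := by
    simpa using (summable_nat_add_iff 1).mpr
      (summable_pow_mul_geometric_of_norm_lt_one 1 (r := ‖x - 1‖) (by simpa using hx))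
  have hbound (j n : ℕ) :
      ‖((p ^ j - 1).choose n : ℂ_[p]) * (x - 1) ^ (n + 1) / (n + 1 : ℕ)‖ ≤
        ((n + 1 : ℕ) : ℝ) * ‖x - 1‖ ^ (n + 1) := by
    rw [div_eq_mul_inv, norm_mul, norm_mul, norm_pow, mul_comm]
    exact mul_le_mul (norm_inv_natCast_le _)
      (mul_le_of_le_one_left (by positivity) (IsUltrametricDist.norm_natCast_le_one _ _))
      (by positivity) (by positivity)
  refine (tendsto_tsum_of_dominated_convergence hsum
    (fun n => ((tendsto_choose_prime_pow_sub_one n).mul_const _).div_const _)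
    (Eventually.of_forall hbound)).congr fun j => ?_
  rw [tsum_choose_prime_pow_sub_one_mul_pow_div, add_sub_cancel]

theorem plog_eq_zero_of_pow_eq_one {x : ℂ_[p]} (hx : ‖x - 1‖ < 1) {n : ℕ} (hn : n ≠ 0)
    (hxn : x ^ n = 1) : plog p x = 0 := by
  have hpow_ne (j : ℕ) : (p : ℂ_[p]) ^ j ≠ 0 :=
    pow_ne_zero _ (Nat.cast_ne_zero.mpr (Fact.out : p.Prime).ne_zero)
  have hone : Tendsto (fun j : ℕ => x ^ p ^ j) atTop (𝓝 1) := by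
    have h := ((tendsto_plog hx).mul tendsto_prime_pow).add_const 1
    simpa only [div_mul_cancel₀ _ (hpow_ne _), sub_add_cancel, mul_zero, zero_add] using h
  have hgeom : Tendsto (fun j : ℕ => ∑ i ∈ Finset.range n, (x ^ p ^ j) ^ i) atTop (𝓝 n) := by
    simpa using tendsto_finsetSum (Finset.range n) fun i _ => hone.pow i
  have hzero (j : ℕ) :
      (x ^ p ^ j - 1) / (p : ℂ_[p]) ^ j * ∑ i ∈ Finset.range n, (x ^ p ^ j) ^ i = 0 := by
    rw [div_mul_eq_mul_div, mul_geom_sum, pow_right_comm, hxn, one_pow, sub_self, zero_div]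
  have hlim := (tendsto_plog hx).mul hgeom
  simp only [hzero] at hlim
  exact (mul_eq_zero.mp (tendsto_nhds_unique hlim tendsto_const_nhds)).resolve_right
    (Nat.cast_ne_zero.mpr hn)

end Log

section Eigen

variable {p : ℕ} [Fact p.Prime]

/-- The inclusion of the `p`-adic integers in the algebraic closure of the `p`-adic numbers. -/
noncomputable def intToAlgCl (p : ℕ) [Fact p.Prime] : ℤ_[p] →+* PadicAlgCl p :=
  (algebraMap ℚ_[p] (PadicAlgCl p)).comp PadicInt.Coe.ringHom

theorem toAlgCl_eq_mapMatrix (A : Matrix (Fin 2) (Fin 2) ℤ_[p]) :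
    toAlgCl p A = (intToAlgCl p).mapMatrix A := rfl

theorem intToAlgCl_comp_ne_zero {y : Fin 2 → ℤ_[p]} (hy : y ≠ 0) : intToAlgCl p ∘ y ≠ 0 := by
  have hinj : Function.Injective (intToAlgCl p) :=
    (algebraMap ℚ_[p] (PadicAlgCl p)).injective.comp Subtype.coe_injective
  exact fun h => hy (funext fun i => hinj (by simpa using congrFun h i))

theorem mk_mem_eigenpoints {A : Matrix (Fin 2) (Fin 2) ℤ_[p]} {y : Fin 2 → ℤ_[p]} (hy : y ≠ 0)
    {μ : ℤ_[p]} (h : A *ᵥ y = μ • y) :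
    Projectivization.mk (PadicAlgCl p) (intToAlgCl p ∘ y) (intToAlgCl_comp_ne_zero hy) ∈
      eigenpoints p A := by
  refine ⟨intToAlgCl p μ, Module.End.mem_eigenspace_iff.mpr ?_, Projectivization.rep_nonzero _⟩
  obtain ⟨c, hc⟩ := Projectivization.exists_smul_eq_mk_rep (PadicAlgCl p) (intToAlgCl p ∘ y)
    (intToAlgCl_comp_ne_zero hy)
  have heigen : toAlgCl p A *ᵥ (intToAlgCl p ∘ y) = intToAlgCl p μ • (intToAlgCl p ∘ y) := by
    ext i
    rw [toAlgCl_eq_mapMatrix, RingHom.mapMatrix_apply, ← RingHom.map_mulVec, h]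
    exact map_mul (intToAlgCl p) _ _
  rw [← hc, Matrix.toLin'_apply, Matrix.mulVec_smul, heigen, smul_comm]

theorem mulVec_ne_smul_of_disjoint_eigenpoints {A₁ A₂ : Matrix (Fin 2) (Fin 2) ℤ_[p]}
    (h : Disjoint (eigenpoints p A₁) (eigenpoints p A₂)) {y : Fin 2 → ℤ_[p]} (hy : y ≠ 0)
    {μ₁ μ₂ : ℤ_[p]} (h₁ : A₁ *ᵥ y = μ₁ • y) : A₂ *ᵥ y ≠ μ₂ • y := fun h₂ =>
  Set.disjoint_left.mp h (mk_mem_eigenpoints hy h₁) (mk_mem_eigenpoints hy h₂)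

namespace SLtilde

variable {A : Matrix (Fin 2) (Fin 2) ℤ_[p]}

theorem isUnit_det (hA : A ∈ SLtilde p) : IsUnit A.det :=
  hA.1.elim (fun h => h ▸ isUnit_one) fun h => h ▸ isUnit_one.neg

theorem eigenvalue_pow_ne_one (hA : A ∈ SLtilde p) {l : PadicAlgCl p}
    (hl : Module.End.HasEigenvalue (Matrix.toLin' (toAlgCl p A)) l) {n : ℕ} (hn : n ≠ 0) :
    l ^ n ≠ 1 := by
  obtain ⟨-, -, κ, -, -, hκ⟩ := hA
  obtain ⟨hnorm, hlog⟩ := hκ l hl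
  refine fun h => hlog (plog_eq_zero_of_pow_eq_one ?_ hn ?_)
  · have hsub : ((l ^ κ : PadicAlgCl p) : ℂ_[p]) - 1 = ((l ^ κ - 1 : PadicAlgCl p) : ℂ_[p]) := by
      simp only [PadicComplex.coe_eq, map_sub, map_one]
    rw [hsub, PadicComplex.norm_extends]
    exact hnorm.trans_lt
      (inv_lt_one_of_one_lt₀ (by exact_mod_cast (Fact.out : p.Prime).one_lt))
  · rw [PadicComplex.coe_eq, ← map_pow, pow_right_comm, h, one_pow, map_one]

theorem pow_notMem_range_scalar (hA : A ∈ SLtilde p) {n : ℕ} (hn : 0 < n) :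
    A ^ n ∉ Set.range (Matrix.scalar (Fin 2)) := by
  rintro ⟨ν, hν⟩
  have hν₄ : ν ^ 4 = 1 := by
    have hdet : ν ^ 2 = A.det ^ n := by
      rw [← Matrix.det_pow, ← hν, Matrix.scalar_apply, Matrix.det_diagonal, Finset.prod_const,
        Finset.card_univ, Fintype.card_fin]
    have hsq : A.det ^ 2 = 1 := sq_eq_one_iff.mpr hA.1
    rw [show 4 = 2 * 2 from rfl, pow_mul, hdet, pow_right_comm, hsq, one_pow]
  have hpow : toAlgCl p A ^ (n * 4) = 1 := by
    rw [toAlgCl_eq_mapMatrix, ← map_pow, pow_mul, ← hν, ← map_pow, hν₄, map_one, map_one]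
  obtain ⟨v, l, hv⟩ := hA.2.1.nonempty
  refine eigenvalue_pow_ne_one hA (Module.End.hasEigenvalue_of_hasEigenvector hv)
    (Nat.mul_ne_zero hn.ne' four_ne_zero) (smul_left_injective _ hv.2 ?_)
  simp only
  rw [← hv.pow_apply, ← Matrix.toLin'_pow, hpow, Matrix.toLin'_one, LinearMap.id_apply, one_smul]

end SLtilde

end Eigen

end PLC

theorem theorem6p1_general (p : ℕ) [Fact p.Prime] (A₁ A₂ : Matrix (Fin 2) (Fin 2) ℤ_[p])
    (hdet₁ : IsUnit A₁.det) (hdet₂ : IsUnit A₂.det)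
    (hA₁ : ∀ n, 0 < n → A₁ ^ n ∉ Set.range (Matrix.scalar (Fin 2)))
    (hA₂ : ∀ n, 0 < n → A₂ ^ n ∉ Set.range (Matrix.scalar (Fin 2)))
    (hA₁₂ : ∀ y : Fin 2 → ℤ_[p], y ≠ 0 → ∀ μ₁ μ₂ : ℤ_[p],
      A₁ *ᵥ y = μ₁ • y → A₂ *ᵥ y ≠ μ₂ • y) :
    ∃ c : ℝ, 0 < c ∧ ∀ (w : ℕ → ℕ) (k : ℕ),
      (∀ n : ℕ, PLC.red p k A₁ ∈ PLC.Vmod p k n w ∧ PLC.red p k A₂ ∈ PLC.Vmod p k n w) →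
      ∀ (x : PLC.Line p) (ε : ℝ), c * ((p : ℝ) ^ k)⁻¹ ≤ ε → (w, x) ∉ PLC.LMad p ε := by
  obtain ⟨M₁, hM₁, Y₁, hY₁⟩ := PLC.exists_pow_eq_one_add_smul hdet₁ 2
  obtain ⟨M₂, hM₂, Y₂, hY₂⟩ := PLC.exists_pow_eq_one_add_smul hdet₂ 2
  obtain ⟨L, hL⟩ := PLC.exists_forall_eigenForm_dvd (Y₁ := Y₁) (Y₂ := Y₂) fun X hX h₁ h₂ => by
    obtain ⟨μ₁, hμ₁⟩ := PLC.exists_mulVec_perp_eq_smul hY₁ (hA₁ M₁ hM₁) hX h₁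
    obtain ⟨μ₂, hμ₂⟩ := PLC.exists_mulVec_perp_eq_smul hY₂ (hA₂ M₂ hM₂) hX h₂
    exact hA₁₂ _ hX.perp.ne_zero μ₁ μ₂ hμ₁ hμ₂
  obtain ⟨c₁, hc₁, hlt₁⟩ := PLC.exists_forall_lt_of_mem_LMad hM₁ hY₁
    (fun h => hA₁ 1 one_pos ⟨1, by rw [h, one_pow, map_one]⟩) L
  obtain ⟨c₂, hc₂, hlt₂⟩ := PLC.exists_forall_lt_of_mem_LMad hM₂ hY₂
    (fun h => hA₂ 1 one_pos ⟨1, by rw [h, one_pow, map_one]⟩) L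
  refine ⟨c₁ + c₂, by positivity, fun w k hw x ε hε hmem => hε.not_gt ?_⟩
  obtain ⟨X, hX, rfl⟩ := PLC.exists_eq_integralPoint x
  rcases hL X hX with hdvd | hdvd
  · exact (hlt₁ w k (fun n => (hw n).1) X hX hdvd ε hmem).trans_le (by gcongr; linarith)
  · exact (hlt₂ w k (fun n => (hw n).2) X hX hdvd ε hmem).trans_le (by gcongr; linarith)

theorem theorem6p1 (p : ℕ) [Fact p.Prime]
    (A₁ A₂ : Matrix (Fin 2) (Fin 2) ℤ_[p])
    (hA₁ : A₁ ∈ PLC.SLtilde p) (hA₂ : A₂ ∈ PLC.SLtilde p)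
    (w₁ w₂ w₃ w₄ : ℙ (PadicAlgCl p) (Fin 2 → PadicAlgCl p))
    (hw₁₂ : PLC.eigenpoints p A₁ = {w₁, w₂}) (hw₃₄ : PLC.eigenpoints p A₂ = {w₃, w₄})
    (hdist : [w₁, w₂, w₃, w₄].Nodup) :
    ∃ c : ℝ, 0 < c ∧
      ∀ (N : ℕ) (w : ℕ → ℕ), w ∈ PLC.words N →
      ∀ k : ℕ,
        (∀ n : ℕ, PLC.red p k A₁ ∈ PLC.Vmod p k n w ∧ PLC.red p k A₂ ∈ PLC.Vmod p k n w) →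
      ∀ (x : PLC.Line p) (ε : ℝ), c * ((p : ℝ) ^ k)⁻¹ ≤ ε → (w, x) ∉ PLC.LMad p ε := by
  have hdisj : Disjoint (PLC.eigenpoints p A₁) (PLC.eigenpoints p A₂) := by
    rw [hw₁₂, hw₃₄]
    simp_all [eq_comm]
  exact (theorem6p1_general p A₁ A₂ (PLC.SLtilde.isUnit_det hA₁) (PLC.SLtilde.isUnit_det hA₂)
    (fun _ => PLC.SLtilde.pow_notMem_range_scalar hA₁)
    (fun _ => PLC.SLtilde.pow_notMem_range_scalar hA₂)
    fun _ hy _ _ => PLC.mulVec_ne_smul_of_disjoint_eigenpoints hdisj hy).imp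
      fun _ hc => ⟨hc.1, fun _ w _ => hc.2 w⟩
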